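/- Let $\mathcal L$ be the set of first-order sentences (with equality) in the language $\{<\}$ of one binary relation symbol. Let $\mathrm{TI}$ be the theory consisting of the axioms of strict linear orders (irreflexivity, transitivity, trichotomy) together with the universal closures of all instances of the transfinite induction schema \[\forall x\,\bigl(\forall y\,(y<x\to\psi(y))\to\psi(x)\bigr)\to\forall x\,\psi(x),\] where $\psi$ ranges over all first-order formulas in the language $\{<\}$, possibly with further free variables as parameters. Structures are nonempty, as usual in first-order logic. Then for every sentence $\varphi\in\mathcal L$ the following are equivalent: (1) $\varphi$ holds in every (nonempty) well-ordered set $\langle L,<\rangle$; (2) $\varphi$ holds in $\langle\alpha,<\rangle$ for every ordinal $\alpha$ with $0<\alpha<\omega^\omega$; (3) $\varphi$ is provable from $\mathrm{TI}$ in classical first-order logic with equality. -/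

import Mathlib

universe u

namespace FirstOrder.Language

open FirstOrder

/-! ### A Hilbert-style proof calculus for classical first-order logic with equality -/

section Calculus

variable {L : Language.{0, 0}}

/-- The formula `φ(t)` obtained from `φ(x)`, where `x` is the unique in-scope bound variable,
by substituting the term `t` for `x`. -/
def BoundedFormula.instantiate (φ : L.BoundedFormula ℕ 1) (t : L.Term ℕ) : L.Formula ℕ :=
  φ.toFormula.subst (Sum.elim Term.var fun _ => t)

/-- `T.Derivable φ`: the formula `φ`, with free variables indexed by `ℕ`, has a formal derivation
from the set of sentences `T`. The primitive connectives are `⊥`, `⟹` and `∀'`. -/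
inductive Theory.Derivable (T : L.Theory) : L.Formula ℕ → Prop
  /-- sentences of `T` are axioms -/
  | ax (σ : L.Sentence) (h : σ ∈ T) :
      Theory.Derivable T (Formula.relabel (Empty.elim : Empty → ℕ) σ)
  /-- modus ponens -/
  | mp (φ ψ : L.Formula ℕ) (h₁ : Theory.Derivable T (φ ⟹ ψ)) (h₂ : Theory.Derivable T φ) :
      Theory.Derivable T ψ
  /-- the propositional axioms -/
  | impK (φ ψ : L.Formula ℕ) : Theory.Derivable T (φ ⟹ (ψ ⟹ φ))
  | impS (φ ψ χ : L.Formula ℕ) :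
      Theory.Derivable T ((φ ⟹ (ψ ⟹ χ)) ⟹ ((φ ⟹ ψ) ⟹ (φ ⟹ χ)))
  | dne (φ : L.Formula ℕ) : Theory.Derivable T (((φ ⟹ ⊥) ⟹ ⊥) ⟹ φ)
  /-- `∀ x, φ(x) → φ(t)` -/
  | allE (φ : L.BoundedFormula ℕ 1) (t : L.Term ℕ) :
      Theory.Derivable T ((∀' φ) ⟹ φ.instantiate t)
  /-- from `ψ → φ(x)` infer `ψ → ∀ x, φ(x)`, if `x` is not free in `ψ` and `∀ x, φ(x)` -/
  | gen (ψ : L.Formula ℕ) (φ : L.BoundedFormula ℕ 1) (x : ℕ)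
      (hψ : x ∉ ψ.freeVarFinset) (hφ : x ∉ φ.freeVarFinset)
      (h : Theory.Derivable T (ψ ⟹ φ.instantiate (Term.var x))) :
      Theory.Derivable T (ψ ⟹ ∀' φ)
  /-- the equality axioms `t = t` and `s = t → φ(s) → φ(t)` -/
  | eqRefl (t : L.Term ℕ) : Theory.Derivable T (t.equal t)
  | eqSubst (φ : L.BoundedFormula ℕ 1) (s t : L.Term ℕ) :
      Theory.Derivable T (s.equal t ⟹ (φ.instantiate s ⟹ φ.instantiate t))

/-- `T ⊢ σ` for a sentence `σ`. -/
def Theory.Proves (T : L.Theory) (σ : L.Sentence) : Prop :=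
  T.Derivable (Formula.relabel (Empty.elim : Empty → ℕ) σ)

end Calculus

/-! ### The language `{<}` and its structures -/

/-- The relation symbols of the language `{<}`: a single binary one. -/
inductive StrictOrderRel : ℕ → Type
  | lt : StrictOrderRel 2

/-- The first-order language `{<}`. -/
def strictOrder : Language.{0, 0} := ⟨fun _ => Empty, StrictOrderRel⟩

/-- The symbol `<`. -/
def ltSymb : strictOrder.Relations 2 := StrictOrderRel.lt

/-- A type with a relation `<` is a structure for the language `{<}`. -/
instance strictOrderStructure (M : Type u) [LT M] : strictOrder.Structure M where
  funMap f := f.elim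
  RelMap | .lt => fun x => x 0 < x 1

/-! ### The theories of linear orders and of transfinite induction -/

/-- The theory of strict linear orders: irreflexivity, transitivity, trichotomy. -/
def strictLinearOrderTheory : strictOrder.Theory :=
  {ltSymb.irreflexive, ltSymb.transitive,
    ∀' ∀' (ltSymb.boundedFormula₂ (&0) &1 ⊔ (Term.bdEqual (&0) &1 ⊔
      ltSymb.boundedFormula₂ (&1) &0))}

/-- The universal closure of
`(∀ x, (∀ y, y < x → φ(y)) → φ(x)) → ∀ x, φ(x)`, where `φ` has the variables `0, …, n`, of which
`0, …, n - 1` are parameters and `n` is `x`. Inside, `y` is the variable `n + 1`, and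
`φ.liftAt 1 n` is `φ(y)`. -/
def transfiniteInduction {n : ℕ} (φ : strictOrder.BoundedFormula Empty (n + 1)) :
    strictOrder.Sentence :=
  BoundedFormula.alls (n := n)
    ((∀' ((∀' (ltSymb.boundedFormula₂ (&(Fin.last (n + 1))) (&(Fin.last n).castSucc) ⟹
        φ.liftAt 1 n)) ⟹ φ)) ⟹ ∀' φ)

/-- The theory `TI`: linear orders together with the transfinite induction schema for all
formulas with parameters. -/
def transfiniteInductionTheory : strictOrder.Theory :=
  strictLinearOrderTheory ∪
    {σ | ∃ (n : ℕ) (φ : strictOrder.BoundedFormula Empty (n + 1)), σ = transfiniteInduction φ}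

end FirstOrder.Language

/-! Ordinals are well-ordered, and well-orders satisfy `TI`, so soundness of the calculus leaves
only (2) → (3). By completeness it is enough that a nonempty model `M` of `TI` satisfies every
sentence true in all nonzero ordinals below `ω ^ ω`.

Truth of a sentence depends only on the depth-`k` type of the order, for `k` large
(`GameEquiv.realize_iff`). For each `k` there are finitely many types, and having a given type is
first-order definable (`IsDefinable.depthType_eq`). Call a set good if it has the depth-`k` type of
an ordinal below `ω ^ ω`. "The initial segment below `x` and all intervals `[a, x)` are good" is
then a legitimate induction formula, and `mem_ordinalDepthTypes` both proves it progressive and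
passes from all `x` to the whole of `M`.

The crux is an order `Y` without greatest element whose bounded pieces are good. A Ramsey-type
argument with an ultrafilter finds an idempotent type `s` and cofinally many points cutting a tail
of `Y` into blocks of type `s`. The type of such a tail is determined by `s` alone, whatever the
cofinality of `Y` (`HasCofinalBlocks.depthType_eq`). If `β` has type `s`, the tail therefore has the
type of `β * ω`, which is still below `ω ^ ω`.

Completeness is a Henkin argument in which the variables themselves serve as witnesses, and
genericity over countably many cofinal sets replaces the step-by-step extension. -/

/-! ### Finite-depth types of subsets of linear orders -/

section DepthType

open Set

/-- The values of depth-`k` types of linearly ordered sets. -/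
def DepthType : ℕ → Type
  | 0 => Unit
  | k + 1 => Set (DepthType k × DepthType k)

instance DepthType.finite : ∀ k, Finite (DepthType k)
  | 0 => inferInstanceAs (Finite Unit)
  | k + 1 =>
    have := DepthType.finite k
    inferInstanceAs (Finite (Set (DepthType k × DepthType k)))

/-- The depth-`k` type of a subset of a linear order: at depth `k + 1` it records the depth-`k`
types of the two parts into which each point cuts the set. Equality of types is the existence of a
winning strategy for Duplicator in the Ehrenfeucht–Fraïssé game of length `k`. -/
def depthType {M : Type*} [LinearOrder M] : (k : ℕ) → Set M → DepthType k
  | 0, _ => ()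
  | k + 1, S =>
    ((fun x => (depthType k (S ∩ Iio x), depthType k (S ∩ Ioi x))) '' S :
      Set (DepthType k × DepthType k))

variable {M N K : Type*} [LinearOrder M] [LinearOrder N] [LinearOrder K]

theorem depthType_succ_eq {k : ℕ} {S : Set M} {t : DepthType (k + 1)} :
    depthType (k + 1) S = t ↔ ∀ p : DepthType k × DepthType k,
      (p ∈ (show Set (DepthType k × DepthType k) from t) ↔
        ∃ x ∈ S, depthType k (S ∩ Iio x) = p.1 ∧ depthType k (S ∩ Ioi x) = p.2) := by
  have h := @Set.ext_iff (DepthType k × DepthType k) (depthType (k + 1) S) t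
  refine h.trans (forall_congr' fun p => ?_)
  have h2 : (p ∈ (show Set (DepthType k × DepthType k) from depthType (k + 1) S)) ↔
      ∃ x ∈ S, depthType k (S ∩ Iio x) = p.1 ∧ depthType k (S ∩ Ioi x) = p.2 := by
    simp only [depthType, Set.mem_image, Prod.ext_iff]
  rw [← h2]
  exact Iff.comm

/-- One round of the game: Duplicator's reply `y` to the move `x`. `depthType_succ_congr` is the
converse, with replies required in both directions. -/
theorem exists_of_depthType_succ_eq {k : ℕ} {S : Set M} {T : Set N}
    (h : depthType (k + 1) S = depthType (k + 1) T) {x : M} (hx : x ∈ S) :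
    ∃ y ∈ T, depthType k (S ∩ Iio x) = depthType k (T ∩ Iio y) ∧
      depthType k (S ∩ Ioi x) = depthType k (T ∩ Ioi y) := by
  have h1 := (depthType_succ_eq.1 h (depthType k (S ∩ Iio x), depthType k (S ∩ Ioi x))).2
    ⟨x, hx, rfl, rfl⟩
  obtain ⟨y, hy, h2, h3⟩ := (depthType_succ_eq.1 rfl _).1 h1
  exact ⟨y, hy, h2.symm, h3.symm⟩

theorem depthType_succ_congr {k : ℕ} {S : Set M} {T : Set N}
    (h₁ : ∀ x ∈ S, ∃ y ∈ T, depthType k (S ∩ Iio x) = depthType k (T ∩ Iio y) ∧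
      depthType k (S ∩ Ioi x) = depthType k (T ∩ Ioi y))
    (h₂ : ∀ y ∈ T, ∃ x ∈ S, depthType k (T ∩ Iio y) = depthType k (S ∩ Iio x) ∧
      depthType k (T ∩ Ioi y) = depthType k (S ∩ Ioi x)) :
    depthType (k + 1) S = depthType (k + 1) T := by
  refine depthType_succ_eq.2 fun p => ⟨fun hp => ?_, ?_⟩
  · obtain ⟨y, hy, h3, h4⟩ := (depthType_succ_eq.1 rfl _).1 hp
    obtain ⟨x, hx, h5, h6⟩ := h₂ y hy
    exact ⟨x, hx, h5.symm.trans h3, h6.symm.trans h4⟩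
  · rintro ⟨x, hx, h3, h4⟩
    obtain ⟨y, hy, h5, h6⟩ := h₁ x hx
    exact (depthType_succ_eq.1 rfl _).2 ⟨y, hy, h5.symm.trans h3, h6.symm.trans h4⟩

theorem depthType_eq_of_succ {k : ℕ} {S : Set M} {T : Set N}
    (h : depthType (k + 1) S = depthType (k + 1) T) : depthType k S = depthType k T := by
  induction k generalizing S T with
  | zero => rfl
  | succ k ih =>
    refine depthType_succ_congr (fun x hx => ?_) fun y hy => ?_
    · obtain ⟨y, hy, h1, h2⟩ := exists_of_depthType_succ_eq h hx
      exact ⟨y, hy, ih h1, ih h2⟩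
    · obtain ⟨x, hx, h1, h2⟩ := exists_of_depthType_succ_eq h.symm hy
      exact ⟨x, hx, (ih h1.symm).symm, (ih h2.symm).symm⟩

theorem depthType_image {f : M → N} (hf : StrictMono f) (k : ℕ) (S : Set M) :
    depthType k (f '' S) = depthType k S := by
  induction k generalizing S with
  | zero => rfl
  | succ k ih =>
    have h1 : ∀ x, f '' S ∩ Iio (f x) = f '' (S ∩ Iio x) := fun x => by
      ext z
      constructor
      · rintro ⟨⟨y, hy, rfl⟩, h⟩
        exact ⟨y, ⟨hy, hf.lt_iff_lt.1 h⟩, rfl⟩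
      · rintro ⟨y, ⟨hy, h⟩, rfl⟩
        exact ⟨⟨y, hy, rfl⟩, hf h⟩
    have h2 : ∀ x, f '' S ∩ Ioi (f x) = f '' (S ∩ Ioi x) := fun x => by
      ext z
      constructor
      · rintro ⟨⟨y, hy, rfl⟩, h⟩
        exact ⟨y, ⟨hy, hf.lt_iff_lt.1 h⟩, rfl⟩
      · rintro ⟨y, ⟨hy, h⟩, rfl⟩
        exact ⟨⟨y, hy, rfl⟩, hf h⟩
    refine depthType_succ_congr ?_ fun x hx => ⟨f x, ⟨x, hx, rfl⟩, ?_⟩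
    · rintro _ ⟨x, hx, rfl⟩
      exact ⟨x, hx, by rw [h1, ih], by rw [h2, ih]⟩
    · exact ⟨by rw [h1, ih], by rw [h2, ih]⟩

theorem depthType_empty (k : ℕ) : depthType k (∅ : Set M) = depthType k (∅ : Set N) := by
  cases k with
  | zero => rfl
  | succ k => exact depthType_succ_congr (by simp) (by simp)

/-! ### Concatenation of ordered sets -/

section Concatenation

variable {S T : Set M} {z : M}

theorem union_inter_Iio_of_mem_left (h : ∀ x ∈ S, ∀ y ∈ T, x < y) (hz : z ∈ S) :
    (S ∪ T) ∩ Iio z = S ∩ Iio z := by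
  rw [union_inter_distrib_right, union_eq_left]
  exact fun w hw => absurd hw.2 (h z hz w hw.1).not_gt

theorem union_inter_Ioi_of_mem_left (h : ∀ x ∈ S, ∀ y ∈ T, x < y) (hz : z ∈ S) :
    (S ∪ T) ∩ Ioi z = S ∩ Ioi z ∪ T := by
  rw [union_inter_distrib_right, inter_eq_left.2 (show T ⊆ Ioi z from fun w hw => h z hz w hw)]

theorem union_inter_Iio_of_mem_right (h : ∀ x ∈ S, ∀ y ∈ T, x < y) (hz : z ∈ T) :
    (S ∪ T) ∩ Iio z = S ∪ T ∩ Iio z := by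
  rw [union_inter_distrib_right, inter_eq_left.2 (show S ⊆ Iio z from fun w hw => h w hw z hz)]

theorem union_inter_Ioi_of_mem_right (h : ∀ x ∈ S, ∀ y ∈ T, x < y) (hz : z ∈ T) :
    (S ∪ T) ∩ Ioi z = T ∩ Ioi z := by
  rw [union_inter_distrib_right, union_eq_right]
  exact fun w hw => absurd hw.2 (h w hw.1 z hz).not_gt

end Concatenation

/-- A move in one summand is answered in the corresponding summand; the other summand is left whole
and only needs its type one depth lower. The induction hypothesis is an argument so that the back
direction can use it with `M` and `N` exchanged. -/
theorem exists_union_of_depthType_succ_eq {k : ℕ}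
    (ih : ∀ (S T : Set M) (S' T' : Set N), (∀ x ∈ S, ∀ y ∈ T, x < y) →
      (∀ x ∈ S', ∀ y ∈ T', x < y) → depthType k S = depthType k S' →
      depthType k T = depthType k T' → depthType k (S ∪ T) = depthType k (S' ∪ T'))
    {S T : Set M} {S' T' : Set N}
    (hST : ∀ x ∈ S, ∀ y ∈ T, x < y) (hST' : ∀ x ∈ S', ∀ y ∈ T', x < y)
    (hS : depthType (k + 1) S = depthType (k + 1) S')
    (hT : depthType (k + 1) T = depthType (k + 1) T') (x : M) (hx : x ∈ S ∪ T) :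
    ∃ y ∈ S' ∪ T', depthType k ((S ∪ T) ∩ Iio x) = depthType k ((S' ∪ T') ∩ Iio y) ∧
      depthType k ((S ∪ T) ∩ Ioi x) = depthType k ((S' ∪ T') ∩ Ioi y) := by
  rcases hx with hx | hx
  · obtain ⟨y, hy, h1, h2⟩ := exists_of_depthType_succ_eq hS hx
    refine ⟨y, .inl hy, ?_, ?_⟩
    · rwa [union_inter_Iio_of_mem_left hST hx, union_inter_Iio_of_mem_left hST' hy]
    · rw [union_inter_Ioi_of_mem_left hST hx, union_inter_Ioi_of_mem_left hST' hy]
      exact ih _ _ _ _ (fun a ha => hST a ha.1) (fun a ha => hST' a ha.1) h2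
        (depthType_eq_of_succ hT)
  · obtain ⟨y, hy, h1, h2⟩ := exists_of_depthType_succ_eq hT hx
    refine ⟨y, .inr hy, ?_, ?_⟩
    · rw [union_inter_Iio_of_mem_right hST hx, union_inter_Iio_of_mem_right hST' hy]
      exact ih _ _ _ _ (fun a ha b hb => hST a ha b hb.1) (fun a ha b hb => hST' a ha b hb.1)
        (depthType_eq_of_succ hS) h1
    · rwa [union_inter_Ioi_of_mem_right hST hx, union_inter_Ioi_of_mem_right hST' hy]

/-- The type of a concatenation depends only on the types of the parts. -/
theorem depthType_union {k : ℕ} {S T : Set M} {S' T' : Set N}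
    (hST : ∀ x ∈ S, ∀ y ∈ T, x < y) (hST' : ∀ x ∈ S', ∀ y ∈ T', x < y)
    (hS : depthType k S = depthType k S') (hT : depthType k T = depthType k T') :
    depthType k (S ∪ T) = depthType k (S' ∪ T') := by
  induction k generalizing S T S' T' with
  | zero => rfl
  | succ k ih =>
    exact depthType_succ_congr
      (exists_union_of_depthType_succ_eq (fun _ _ _ _ h h' => ih h h') hST hST' hS hT)
      (exists_union_of_depthType_succ_eq
        (fun _ _ _ _ h h' e e' => (ih h' h e.symm e'.symm).symm) hST' hST hS.symm hT.symm)

/-- `B` is cofinal in `Y`, the part of `Y` below each point of `B` has the type of `R`, and so do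
cofinally many of the intervals of `Y` starting at that point and ending in `B`. -/
structure HasCofinalBlocks (k : ℕ) (R : Set K) (Y B : Set M) : Prop where
  subset : B ⊆ Y
  cofinal : ∀ y ∈ Y, ∃ b ∈ B, y < b
  initial : ∀ b ∈ B, depthType k (Y ∩ Iio b) = depthType k R
  block : ∀ b ∈ B, ∀ y ∈ Y, ∃ c ∈ B, y < c ∧ b < c ∧ depthType k (Y ∩ Ico b c) = depthType k R

theorem inter_Iio_union_inter_Ico (Y : Set M) {a b : M} (h : a ≤ b) :
    Y ∩ Iio a ∪ Y ∩ Ico a b = Y ∩ Iio b := by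
  rw [← inter_union_distrib_left, Iio_union_Ico_eq_Iio h]

theorem inter_Ico_union_inter_Ico (Y : Set M) {a b c : M} (h : a ≤ b) (h' : b ≤ c) :
    Y ∩ Ico a b ∪ Y ∩ Ico b c = Y ∩ Ico a c := by
  rw [← inter_union_distrib_left, Ico_union_Ico_eq_Ico h h']

theorem HasCofinalBlocks.of_succ {k : ℕ} {R : Set K} {Y B : Set M}
    (h : HasCofinalBlocks (k + 1) R Y B) : HasCofinalBlocks k R Y B where
  subset := h.subset
  cofinal := h.cofinal
  initial b hb := depthType_eq_of_succ (h.initial b hb)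
  block b hb y hy :=
    let ⟨c, hc, h1, h2, h3⟩ := h.block b hb y hy
    ⟨c, hc, h1, h2, depthType_eq_of_succ h3⟩

/-- Cutting at a block point leaves a tail of the same kind. This self-similarity drives the
induction in `HasCofinalBlocks.depthType_eq`. -/
theorem HasCofinalBlocks.inter_Ici {k : ℕ} {R : Set K} {Y B : Set M}
    (h : HasCofinalBlocks k R Y B) {b : M} (hb : b ∈ B) :
    HasCofinalBlocks k R (Y ∩ Ici b)
      {c | c ∈ B ∧ b < c ∧ depthType k (Y ∩ Ico b c) = depthType k R} where
  subset c hc := ⟨h.subset hc.1, hc.2.1.le⟩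
  cofinal y hy :=
    let ⟨c, hc, h1, h2, h3⟩ := h.block b hb y hy.1
    ⟨c, ⟨hc, h2, h3⟩, h1⟩
  initial c hc := by rw [inter_assoc, Ici_inter_Iio]; exact hc.2.2
  block c hc y hy := by
    obtain ⟨d, hd, h1, h2, h3⟩ := h.block c hc.1 y hy.1
    refine ⟨d, ⟨hd, hc.2.1.trans h2, ?_⟩, h1, h2, ?_⟩
    -- The type of `R` is idempotent: the parts below `b`, below `c` and from `b` to `c` all have
    -- it. Hence joining the blocks from `b` to `c` and from `c` to `d` gives it again.
    · rw [← inter_Ico_union_inter_Ico Y hc.2.1.le h2.le, ← h.initial c hc.1,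
        ← inter_Iio_union_inter_Ico Y hc.2.1.le]
      exact depthType_union (fun x hx y hy => hx.2.2.trans_le hy.2.1)
        (fun x hx y hy => (mem_Iio.1 hx.2).trans_le hy.2.1)
        (hc.2.2.trans (h.initial b hb).symm) (h3.trans hc.2.2.symm)
    · rw [inter_assoc, inter_eq_right.2 (Ico_subset_Ici_self.trans (Ici_subset_Ici.2 hc.2.1.le))]
      exact h3

/-- Choose `b ∈ B` beyond the move `x` and any `b' ∈ B'`. The parts below `b` and `b'` both have the
type of `R`, so `x` is answered below `b'`. The tails from `b` and `b'` have cofinal blocks again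
and agree at depth `k` by induction. -/
theorem HasCofinalBlocks.exists_forth {k : ℕ} {R : Set K} {Y B : Set M} {Y' B' : Set N}
    (ih : ∀ (Y B : Set M) (Y' B' : Set N), Y.Nonempty → Y'.Nonempty → HasCofinalBlocks k R Y B →
      HasCofinalBlocks k R Y' B' → depthType k Y = depthType k Y')
    (hY' : Y'.Nonempty) (h : HasCofinalBlocks (k + 1) R Y B)
    (h' : HasCofinalBlocks (k + 1) R Y' B') (x : M) (hx : x ∈ Y) :
    ∃ y ∈ Y', depthType k (Y ∩ Iio x) = depthType k (Y' ∩ Iio y) ∧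
      depthType k (Y ∩ Ioi x) = depthType k (Y' ∩ Ioi y) := by
  obtain ⟨b, hb, hxb⟩ := h.cofinal x hx
  obtain ⟨y₀, hy₀⟩ := hY'
  obtain ⟨b', hb', -⟩ := h'.cofinal y₀ hy₀
  obtain ⟨y, hy, h1, h2⟩ := exists_of_depthType_succ_eq
    ((h.initial b hb).trans (h'.initial b' hb').symm) (show x ∈ Y ∩ Iio b from ⟨hx, hxb⟩)
  have e : depthType k (Y ∩ Ici b) = depthType k (Y' ∩ Ici b') :=
    ih _ _ _ _ ⟨b, h.subset hb, le_rfl⟩ ⟨b', h'.subset hb', le_rfl⟩ (h.of_succ.inter_Ici hb)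
      (h'.of_succ.inter_Ici hb')
  refine ⟨y, hy.1, ?_, ?_⟩
  · rwa [inter_assoc, inter_assoc, inter_eq_right.2 (Iio_subset_Iio hxb.le),
      inter_eq_right.2 (Iio_subset_Iio (mem_Iio.1 hy.2).le)] at h1
  · rw [← Ioo_union_Ici_eq_Ioi hxb, ← Ioo_union_Ici_eq_Ioi (mem_Iio.1 hy.2),
      inter_union_distrib_left, inter_union_distrib_left]
    rw [inter_assoc, inter_assoc, Iio_inter_Ioi, Iio_inter_Ioi] at h2
    exact depthType_union (fun x hx y hy => hx.2.2.trans_le hy.2)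
      (fun x hx y hy => hx.2.2.trans_le hy.2) h2 e

theorem HasCofinalBlocks.depthType_eq {k : ℕ} {R : Set K} {Y B : Set M} {Y' B' : Set N}
    (hY : Y.Nonempty) (hY' : Y'.Nonempty) (h : HasCofinalBlocks k R Y B)
    (h' : HasCofinalBlocks k R Y' B') : depthType k Y = depthType k Y' := by
  induction k generalizing Y B Y' B' with
  | zero => rfl
  | succ k ih =>
    exact depthType_succ_congr
      (h.exists_forth (fun _ _ _ _ hY hY' h h' => ih hY hY' h h') hY' h')
      (h'.exists_forth (fun _ _ _ _ hY hY' h h' => (ih hY' hY h' h).symm) hY h)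

end DepthType

/-! ### Types of ordinals below `ω ^ ω` -/

section OrdinalTypes

open Set Ordinal

variable {M : Type*} [LinearOrder M] {k : ℕ}

/-- The depth-`k` types of the ordinals below `ω ^ ω`. -/
def ordinalDepthTypes (k : ℕ) : Set (DepthType k) :=
  {t | ∃ α : Ordinal.{u}, α < ω ^ ω ∧ depthType k (Iio α) = t}

theorem Ordinal.image_add_Iio (α β : Ordinal.{u}) : (α + ·) '' Iio β = Ico α (α + β) := by
  ext γ
  constructor
  · rintro ⟨δ, hδ, rfl⟩
    exact ⟨le_self_add, add_lt_add_right hδ α⟩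
  · rintro ⟨h1, h2⟩
    refine ⟨γ - α, ?_, Ordinal.add_sub_cancel_of_le h1⟩
    rwa [mem_Iio, ← add_lt_add_iff_left α, Ordinal.add_sub_cancel_of_le h1]

theorem Ordinal.depthType_Ico (α β : Ordinal.{u}) :
    depthType k (Ico α (α + β)) = depthType k (Iio β) := by
  rw [← Ordinal.image_add_Iio]
  exact depthType_image (fun _ _ h => add_lt_add_right h α) k _

theorem Ordinal.depthType_Iio_add {α β : Ordinal.{u}} {S T : Set M}
    (hST : ∀ x ∈ S, ∀ y ∈ T, x < y) (hS : depthType k (Iio α) = depthType k S)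
    (hT : depthType k (Iio β) = depthType k T) :
    depthType k (Iio (α + β)) = depthType k (S ∪ T) := by
  rw [← Iio_union_Ico_eq_Iio (le_self_add : α ≤ α + β)]
  exact depthType_union (fun x hx y hy => (mem_Iio.1 hx).trans_le hy.1) hST hS
    ((depthType_Ico α β).trans hT)

theorem union_mem_ordinalDepthTypes {S T : Set M} (hST : ∀ x ∈ S, ∀ y ∈ T, x < y)
    (hS : depthType k S ∈ ordinalDepthTypes.{u} k) (hT : depthType k T ∈ ordinalDepthTypes.{u} k) :
    depthType k (S ∪ T) ∈ ordinalDepthTypes.{u} k := by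
  obtain ⟨α, hα, h1⟩ := hS
  obtain ⟨β, hβ, h2⟩ := hT
  exact ⟨α + β, isPrincipal_add_omega0_opow ω hα hβ, depthType_Iio_add hST h1 h2⟩

theorem empty_mem_ordinalDepthTypes : depthType k (∅ : Set M) ∈ ordinalDepthTypes.{u} k :=
  ⟨0, opow_pos _ omega0_pos, by rw [← bot_eq_zero, Iio_bot]; exact depthType_empty k⟩

theorem singleton_mem_ordinalDepthTypes (x : M) :
    depthType k {x} ∈ ordinalDepthTypes.{u} k := by
  refine ⟨1, ?_, ?_⟩
  · simp
  · rw [show Iio (1 : Ordinal.{u}) = (fun _ : PUnit.{1} => (0 : Ordinal.{u})) '' {PUnit.unit} by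
        simp,
      depthType_image (fun a b h => absurd h (by simp)),
      ← depthType_image (M := PUnit.{1}) (f := fun _ => x) (fun a b h => absurd h (by simp)) k
        {PUnit.unit}, image_singleton]

/-- The multiples of `β` form cofinal blocks in `β * ω` if the type of `β` is idempotent. -/
theorem Ordinal.hasCofinalBlocks_mul_omega0 {β : Ordinal.{u}} (hβ : 0 < β)
    (h : depthType k (Iio (β + β)) = depthType k (Iio β)) :
    -- The multiples start at `β * 1`: below `β * 0` there is nothing, so the initial part would
    -- have the empty type.
    HasCofinalBlocks k (Iio β) (Iio (β * ω)) (range fun n : ℕ => β * (n + 1)) := by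
  have hpos : ∀ n : ℕ, depthType k (Iio (β * (n + 1))) = depthType k (Iio β) := by
    intro n
    induction n with
    | zero => simp
    | succ n ih =>
      rw [mul_add, mul_one, Nat.cast_succ]
      refine (depthType_Iio_add (fun x hx y hy => ?_) ih (depthType_Ico β β).symm).trans
        (Eq.trans ?_ h)
      · exact (mem_Iio.1 hx).trans_le hy.1
      · rw [Iio_union_Ico_eq_Iio le_self_add]
  have hlt : ∀ n : ℕ, β * (n + 1) < β * ω := fun n => by
    rw [mul_lt_mul_iff_right₀ hβ]
    exact_mod_cast natCast_lt_omega0 (n + 1)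
  have hcof : ∀ y < β * ω, ∃ n : ℕ, ∀ m : ℕ, n ≤ m → y < β * (m + 1) := fun y hy => by
    obtain ⟨c, hc, h2⟩ := (lt_mul_iff_of_isSuccLimit isSuccLimit_omega0).1 hy
    obtain ⟨n, rfl⟩ := lt_omega0.1 hc
    refine ⟨n, fun m hm => h2.trans_le (mul_le_mul_right ?_ β)⟩
    exact_mod_cast hm.trans (Nat.le_succ m)
  refine ⟨?_, fun y hy => ?_, ?_, ?_⟩
  · rintro _ ⟨n, rfl⟩
    exact hlt n
  · obtain ⟨n, hn⟩ := hcof y hy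
    exact ⟨_, ⟨n, rfl⟩, hn n le_rfl⟩
  · rintro _ ⟨n, rfl⟩
    rw [Iio_inter_Iio, inf_eq_right.2 (hlt n).le]
    exact hpos n
  · rintro _ ⟨n, rfl⟩ y hy
    obtain ⟨m, hm⟩ := hcof y hy
    refine ⟨_, ⟨n + m + 1, rfl⟩, hm _ (by omega), ?_, ?_⟩
    · show β * (n + 1) < β * ((n + m + 1 : ℕ) + 1)
      rw [mul_lt_mul_iff_right₀ hβ]
      exact_mod_cast (by omega : n + 1 < n + m + 1 + 1)
    · show depthType k (Iio (β * ω) ∩ Ico (β * (n + 1)) (β * ((n + m + 1 : ℕ) + 1))) = _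
      rw [inter_eq_right.2 fun z hz => hz.2.trans (hlt _),
        show β * ((n + m + 1 : ℕ) + 1) = β * (n + 1) + β * (m + 1) by
          rw [← mul_add]; congr 1; norm_cast; omega, depthType_Ico]
      exact hpos m

theorem Ordinal.mul_omega0_lt_omega0_opow_omega0 {β : Ordinal.{u}} (h : β < ω ^ ω) :
    β * ω < ω ^ ω := by
  obtain ⟨c, hc, h1⟩ := (lt_opow_of_isSuccLimit omega0_ne_zero isSuccLimit_omega0).1 h
  calc β * ω ≤ ω ^ c * ω := mul_le_mul_left h1.le ω
    _ = ω ^ (Order.succ c) := (opow_succ _ _).symm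
    _ < ω ^ ω := (opow_lt_opow_iff_right one_lt_omega0).2 (isSuccLimit_omega0.succ_lt hc)

/-- The cofinality of `Y` need not be countable, so Ramsey's theorem along a cofinal `ω`-sequence is
not available. An ultrafilter containing all final segments of `Y` does the same work. -/
theorem mem_ordinalDepthTypes_of_cofinal {Y : Set M} (hY : Y.Nonempty)
    (hmax : ∀ y ∈ Y, ∃ z ∈ Y, y < z)
    (h₁ : ∀ b ∈ Y, depthType k (Y ∩ Iio b) ∈ ordinalDepthTypes.{u} k)
    (h₂ : ∀ a ∈ Y, ∀ b ∈ Y, a < b → depthType k (Y ∩ Ico a b) ∈ ordinalDepthTypes.{u} k) :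
    depthType k Y ∈ ordinalDepthTypes.{u} k := by
  have := hY.to_subtype
  have : NoMaxOrder Y := ⟨fun y => let ⟨z, hz, h⟩ := hmax y y.2; ⟨⟨z, hz⟩, h⟩⟩
  let U : Ultrafilter Y := .of Filter.atTop
  have hU : ∀ a : Y, ∀ᶠ b in (U : Filter Y), a < b := fun a =>
    Ultrafilter.of_le _ (Filter.eventually_gt_atTop a)
  have pigeonhole : ∀ f : Y → DepthType k, ∃ s, ∀ᶠ y in (U : Filter Y), f y = s := fun f => by
    obtain ⟨s, hs⟩ := (U.map f).eq_pure_of_finite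
    refine ⟨s, ?_⟩
    have : {s} ∈ U.map f := by rw [hs]; exact Filter.mem_pure.2 rfl
    exact this
  -- `f a` is the type of `[a, c)` for almost all `c`, and `s` is the value of `f a` for almost all
  -- `a`.
  choose f hf using fun a : Y => pigeonhole fun c => depthType k (Y ∩ Ico (a : M) c)
  obtain ⟨s, hs⟩ := pigeonhole f
  have hs' : ∀ᶠ a : Y in (U : Filter Y), ∀ᶠ c : Y in (U : Filter Y),
      depthType k (Y ∩ Ico (a : M) c) = s := hs.mono fun a ha => ha ▸ hf a
  obtain ⟨a, ha⟩ := hs'.exists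
  obtain ⟨b, ⟨hb1, hb2⟩, hab⟩ := ((hs'.and ha).and (hU a)).exists
  obtain ⟨β, hβ, hβs⟩ := h₂ a a.2 b b.2 hab
  rw [hb2] at hβs
  -- Depth `0` does not distinguish empty from nonempty sets, so `β` could be `0` there; but then
  -- any type is good. At positive depth `β` is nonzero because `[a, b)` contains `a`.
  by_cases hk : k = 0
  · subst hk
    exact ⟨β, hβ, rfl⟩
  have hβ0 : 0 < β := by
    rw [pos_iff_ne_zero]
    rintro rfl
    obtain ⟨l, rfl⟩ := Nat.exists_eq_succ_of_ne_zero hk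
    obtain ⟨x, hx, -⟩ := exists_of_depthType_succ_eq (hb2.trans hβs.symm)
      (show (a : M) ∈ Y ∩ Ico (a : M) b from ⟨a.2, le_rfl, hab⟩)
    exact not_lt_zero (mem_Iio.1 hx)
  -- The last condition on `c`, that `[c, d)` has type `s` for almost all `d`, is what allows the
  -- next block to be chosen.
  have hB : HasCofinalBlocks k (Iio β) (Y ∩ Ici (a : M))
      {c | ∃ h : c ∈ Y, a < c ∧ depthType k (Y ∩ Ico (a : M) c) = s ∧
        ∀ᶠ d : Y in (U : Filter Y), depthType k (Y ∩ Ico c d) = s} := by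
    refine ⟨?_, ?_, ?_, ?_⟩
    · rintro c ⟨hc, hac, -⟩
      exact ⟨hc, hac.le⟩
    · rintro y ⟨hy, -⟩
      obtain ⟨c, ⟨⟨h1, h2⟩, h3⟩, h4⟩ := (((hs'.and ha).and (hU a)).and (hU ⟨y, hy⟩)).exists
      exact ⟨c, ⟨c.2, h3, h2, h1⟩, h4⟩
    · rintro c ⟨-, -, h, -⟩
      rw [inter_assoc, Ici_inter_Iio, h, hβs]
    · rintro c ⟨hc, hac, h, hc'⟩ y ⟨hy, -⟩
      obtain ⟨d, ⟨⟨⟨⟨h1, h2⟩, h3⟩, h4⟩, h5⟩, h6⟩ :=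
        (((((hs'.and ha).and (hU a)).and (hU ⟨y, hy⟩)).and (hU ⟨c, hc⟩)).and hc').exists
      refine ⟨d, ⟨d.2, h3, h2, h1⟩, h4, h5, ?_⟩
      rw [inter_assoc, inter_eq_right.2 (Ico_subset_Ici_self.trans (Ici_subset_Ici.2 hac.le)), h6,
        hβs]
  -- For a suitable `c`, the intervals `[a, b)`, `[b, c)` and their union `[a, c)` all have type
  -- `s`.
  have hidem : depthType k (Iio (β + β)) = depthType k (Iio β) := by
    obtain ⟨c, ⟨⟨h1, h2⟩, h3⟩⟩ := ((ha.and hb1).and (hU b)).exists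
    rw [depthType_Iio_add (fun x hx y hy => hx.2.2.trans_le hy.2.1) (hβs.trans hb2.symm)
      (hβs.trans h2.symm), inter_Ico_union_inter_Ico Y hab.le h3.le, h1, hβs]
  have htail : depthType k (Y ∩ Ici (a : M)) ∈ ordinalDepthTypes.{u} k :=
    ⟨β * ω, mul_omega0_lt_omega0_opow_omega0 hβ,
      (hasCofinalBlocks_mul_omega0 hβ0 hidem).depthType_eq ⟨0, mul_pos hβ0 omega0_pos⟩
        ⟨a, a.2, le_rfl⟩ hB⟩
  have := union_mem_ordinalDepthTypes
    (fun x hx y hy => (mem_Iio.1 hx.2).trans_le hy.2) (h₁ a a.2) htail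
  rwa [← inter_union_distrib_left, Iio_union_Ici, inter_univ] at this

/-- A set has the type of an ordinal below `ω ^ ω` as soon as its proper initial segments and its
bounded intervals do. -/
theorem mem_ordinalDepthTypes {Y : Set M}
    (h₁ : ∀ b ∈ Y, depthType k (Y ∩ Iio b) ∈ ordinalDepthTypes.{u} k)
    (h₂ : ∀ a ∈ Y, ∀ b ∈ Y, a < b → depthType k (Y ∩ Ico a b) ∈ ordinalDepthTypes.{u} k) :
    depthType k Y ∈ ordinalDepthTypes.{u} k := by
  rcases Y.eq_empty_or_nonempty with rfl | hY
  · exact empty_mem_ordinalDepthTypes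
  by_cases hmax : ∀ y ∈ Y, ∃ z ∈ Y, y < z
  · exact mem_ordinalDepthTypes_of_cofinal hY hmax h₁ h₂
  · push Not at hmax
    obtain ⟨m, hm, hmax⟩ := hmax
    have := union_mem_ordinalDepthTypes (fun x hx y hy => by rw [hy]; exact hx.2) (h₁ m hm)
      (singleton_mem_ordinalDepthTypes.{u} m)
    rwa [show Y ∩ Iio m ∪ {m} = Y from ?_] at this
    ext z
    constructor
    · rintro (h | rfl)
      exacts [h.1, hm]
    · intro hz
      rcases (hmax z hz).lt_or_eq with h | h
      exacts [.inl ⟨hz, h⟩, .inr h]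

/-- Induction on the points of `M` for the property that the intervals ending there have the types
of ordinals below `ω ^ ω` gives the whole of `M` such a type. -/
theorem univ_mem_ordinalDepthTypes
    (h : (∀ x : M, (∀ y < x, depthType k (Iio y) ∈ ordinalDepthTypes.{u} k ∧
        ∀ a < y, depthType k (Ico a y) ∈ ordinalDepthTypes.{u} k) →
      depthType k (Iio x) ∈ ordinalDepthTypes.{u} k ∧
        ∀ a < x, depthType k (Ico a x) ∈ ordinalDepthTypes.{u} k) →
      ∀ x : M, depthType k (Iio x) ∈ ordinalDepthTypes.{u} k ∧
        ∀ a < x, depthType k (Ico a x) ∈ ordinalDepthTypes.{u} k) :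
    depthType k (univ : Set M) ∈ ordinalDepthTypes.{u} k := by
  -- Every proper initial segment or bounded interval of `Iio x` or `Ico a x` is empty or is a
  -- segment or interval ending at some `b < x`. This is why the induction property must speak of
  -- intervals as well as of initial segments.
  have h' := h fun x hx => ⟨mem_ordinalDepthTypes (fun b hb => ?_) fun a ha b hb hab => ?_,
    fun a ha => mem_ordinalDepthTypes (fun b hb => ?_) fun c hc b hb hcb => ?_⟩
  · exact mem_ordinalDepthTypes (fun b _ => by simpa using (h' b).1)
      fun a _ b _ hab => by simpa using (h' b).2 a hab
  · rw [Iio_inter_Iio, inf_eq_right.2 (mem_Iio.1 hb).le]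
    exact (hx b hb).1
  · rw [inter_eq_right.2 fun z hz => hz.2.trans hb]
    exact (hx b hb).2 a hab
  · rw [Ico_inter_Iio, min_eq_right hb.2.le]
    rcases hb.1.eq_or_lt with rfl | h
    · rw [Ico_self]
      exact empty_mem_ordinalDepthTypes
    · exact (hx b hb.2).2 a h
  · rw [inter_eq_right.2 (Ico_subset_Ico hc.1 hb.2.le)]
    exact (hx b hb.2).2 c hcb

end OrdinalTypes

namespace FirstOrder.Language

open FirstOrder Set

/-! ### The Ehrenfeucht–Fraïssé game -/

/-- The number of implications and quantifiers in a formula. -/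
def BoundedFormula.complexity {L : Language} {α : Type*} :
    ∀ {n : ℕ}, L.BoundedFormula α n → ℕ
  | _, .falsum => 0
  | _, .equal _ _ => 0
  | _, .rel _ _ => 0
  | _, .imp φ ψ => φ.complexity + ψ.complexity + 1
  | _, .all φ => φ.complexity + 1

theorem strictOrder_term_eq_var {α : Type*} (t : strictOrder.Term α) : ∃ a, t = Term.var a := by
  cases t with
  | var a => exact ⟨a, rfl⟩
  | func f _ => exact Empty.elim f

theorem realize_ltSymb {M : Type*} [LT M] {α : Type*} {n : ℕ} {t₁ t₂ : strictOrder.Term (α ⊕ Fin n)}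
    {v : α → M} {xs : Fin n → M} : (ltSymb.boundedFormula₂ t₁ t₂).Realize v xs ↔
      t₁.realize (Sum.elim v xs) < t₂.realize (Sum.elim v xs) :=
  BoundedFormula.realize_rel₂

section Game

variable {M N : Type*} [LinearOrder M] [LinearOrder N] {n k : ℕ}

/-- The points lying above `xs i` for `i ∈ c` and below `xs i` for `i ∉ c`. -/
def cutSet (xs : Fin n → M) (c : Set (Fin n)) : Set M :=
  {z | ∀ i, (i ∈ c → xs i < z) ∧ (i ∉ c → z < xs i)}

/-- If some `xs i` separates `x` from a cut, then `x` does not split it: one part is empty and the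
other is everything. The next three lemmas are the remaining cases. -/
theorem cutSet_inter_Iio_of_mem {xs : Fin n → M} {c : Set (Fin n)} {i : Fin n} {x : M}
    (hi : i ∈ c) (hx : x ≤ xs i) : cutSet xs c ∩ Iio x = ∅ :=
  eq_empty_of_forall_notMem fun _ hz => (hz.2.trans (hx.trans_lt ((hz.1 i).1 hi))).false

theorem cutSet_inter_Ioi_of_mem {xs : Fin n → M} {c : Set (Fin n)} {i : Fin n} {x : M}
    (hi : i ∈ c) (hx : x ≤ xs i) : cutSet xs c ∩ Ioi x = cutSet xs c :=
  inter_eq_left.2 fun _ hz => hx.trans_lt ((hz i).1 hi)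

theorem cutSet_inter_Iio_of_notMem {xs : Fin n → M} {c : Set (Fin n)} {i : Fin n} {x : M}
    (hi : i ∉ c) (hx : xs i ≤ x) : cutSet xs c ∩ Iio x = cutSet xs c :=
  inter_eq_left.2 fun _ hz => ((hz i).2 hi).trans_le hx

theorem cutSet_inter_Ioi_of_notMem {xs : Fin n → M} {c : Set (Fin n)} {i : Fin n} {x : M}
    (hi : i ∉ c) (hx : xs i ≤ x) : cutSet xs c ∩ Ioi x = ∅ :=
  eq_empty_of_forall_notMem fun _ hz =>
    ((mem_Ioi.1 hz.2).trans (((hz.1 i).2 hi).trans_le hx)).false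

open Classical in
theorem cutSet_snoc (xs : Fin n → M) (x : M) (c : Set (Fin (n + 1))) :
    cutSet (Fin.snoc xs x : Fin (n + 1) → M) c =
      cutSet xs {i | i.castSucc ∈ c} ∩ if Fin.last n ∈ c then Ioi x else Iio x := by
  ext z
  simp only [cutSet, mem_ofPred_eq, Fin.forall_fin_succ', Fin.snoc_castSucc, Fin.snoc_last,
    mem_inter_iff]
  split_ifs with h <;> simp [h]

/-- The tuples `xs` and `ys` are ordered in the same way, and corresponding intervals between them
have the same depth-`k` types. -/
structure GameEquiv (k : ℕ) (xs : Fin n → M) (ys : Fin n → N) : Prop where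
  lt_iff : ∀ i j, xs i < xs j ↔ ys i < ys j
  depthType_cutSet : ∀ c, depthType k (cutSet xs c) = depthType k (cutSet ys c)

theorem GameEquiv.symm {xs : Fin n → M} {ys : Fin n → N} (h : GameEquiv k xs ys) :
    GameEquiv k ys xs :=
  ⟨fun i j => (h.lt_iff i j).symm, fun c => (h.depthType_cutSet c).symm⟩

theorem GameEquiv.eq_iff {xs : Fin n → M} {ys : Fin n → N} (h : GameEquiv k xs ys) (i j : Fin n) :
    xs i = xs j ↔ ys i = ys j := by
  rw [eq_iff_le_not_lt, eq_iff_le_not_lt, ← not_lt, ← not_lt, h.lt_iff, h.lt_iff]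

theorem GameEquiv.snoc {xs : Fin n → M} {ys : Fin n → N} {x : M} {y : N}
    (h : ∀ i j, xs i < xs j ↔ ys i < ys j) (h₁ : ∀ i, xs i < x ↔ ys i < y)
    (h₂ : ∀ i, x < xs i ↔ y < ys i)
    (h₃ : ∀ c, depthType k (cutSet xs c ∩ Iio x) = depthType k (cutSet ys c ∩ Iio y) ∧
      depthType k (cutSet xs c ∩ Ioi x) = depthType k (cutSet ys c ∩ Ioi y)) :
    GameEquiv k (Fin.snoc xs x : Fin (n + 1) → M) (Fin.snoc ys y : Fin (n + 1) → N) where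
  lt_iff i j := by
    induction i using Fin.lastCases <;> induction j using Fin.lastCases <;>
      simp [h, h₁, h₂]
  depthType_cutSet c := by
    rw [cutSet_snoc, cutSet_snoc]
    split_ifs
    exacts [(h₃ _).2, (h₃ _).1]

/-- A repeated point `xs i` is answered by `ys i`. A new point is answered inside the cut
corresponding to the one containing it; no other cut is split, so one depth is spent on that cut
alone. -/
theorem GameEquiv.exists_snoc {xs : Fin n → M} {ys : Fin n → N} (h : GameEquiv (k + 1) xs ys)
    (x : M) : ∃ y, GameEquiv k (Fin.snoc xs x : Fin (n + 1) → M)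
      (Fin.snoc ys y : Fin (n + 1) → N) := by
  by_cases hx : ∃ i, x = xs i
  · obtain ⟨i, rfl⟩ := hx
    refine ⟨ys i, .snoc h.lt_iff (fun j => h.lt_iff j i) (fun j => h.lt_iff i j) fun c => ?_⟩
    have hc := depthType_eq_of_succ (h.depthType_cutSet c)
    by_cases hi : i ∈ c
    · rw [cutSet_inter_Iio_of_mem hi le_rfl, cutSet_inter_Iio_of_mem hi le_rfl,
        cutSet_inter_Ioi_of_mem hi le_rfl, cutSet_inter_Ioi_of_mem hi le_rfl]
      exact ⟨depthType_empty k, hc⟩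
    · rw [cutSet_inter_Iio_of_notMem hi le_rfl, cutSet_inter_Iio_of_notMem hi le_rfl,
        cutSet_inter_Ioi_of_notMem hi le_rfl, cutSet_inter_Ioi_of_notMem hi le_rfl]
      exact ⟨hc, depthType_empty k⟩
  · push Not at hx
    have hx' : ∀ i, ¬ xs i < x → x < xs i := fun i hi => (not_lt.1 hi).lt_of_ne (hx i)
    obtain ⟨y, hy, h1, h2⟩ := exists_of_depthType_succ_eq (h.depthType_cutSet {i | xs i < x})
      (show x ∈ cutSet xs {i | xs i < x} from fun i => ⟨id, hx' i⟩)
    have hlt : ∀ i, xs i < x ↔ ys i < y := fun i =>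
      ⟨(hy i).1, fun hi => by_contra fun hn => ((hy i).2 hn).asymm hi⟩
    have hgt : ∀ i, x < xs i ↔ y < ys i := fun i =>
      ⟨fun hi => (hy i).2 hi.asymm, fun hi => hx' i fun hn => ((hlt i).1 hn).asymm hi⟩
    refine ⟨y, .snoc h.lt_iff hlt hgt fun c => ?_⟩
    have hc := depthType_eq_of_succ (h.depthType_cutSet c)
    by_cases hcx : c = {i | xs i < x}
    · rw [hcx]
      exact ⟨h1, h2⟩
    · obtain ⟨i, hi⟩ := not_forall.1 (mt Set.ext hcx)
      by_cases hic : i ∈ c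
      · have hxi : x < xs i := hx' i fun hn => hi ⟨fun _ => hn, fun _ => hic⟩
        have hyi := (hgt i).1 hxi
        rw [cutSet_inter_Iio_of_mem hic hxi.le, cutSet_inter_Iio_of_mem hic hyi.le,
          cutSet_inter_Ioi_of_mem hic hxi.le, cutSet_inter_Ioi_of_mem hic hyi.le]
        exact ⟨depthType_empty k, hc⟩
      · have hxi : xs i < x := by_contra fun hn => hi ⟨fun h => absurd h hic, fun h => absurd h hn⟩
        have hyi := (hlt i).1 hxi
        rw [cutSet_inter_Iio_of_notMem hic hxi.le, cutSet_inter_Iio_of_notMem hic hyi.le,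
          cutSet_inter_Ioi_of_notMem hic hxi.le, cutSet_inter_Ioi_of_notMem hic hyi.le]
        exact ⟨hc, depthType_empty k⟩

/-- The Ehrenfeucht–Fraïssé theorem for linear orders. -/
theorem GameEquiv.realize_iff (φ : strictOrder.BoundedFormula Empty n) {k : ℕ}
    (hk : φ.complexity ≤ k) {xs : Fin n → M} {ys : Fin n → N} (h : GameEquiv k xs ys)
    (v : Empty → M) (w : Empty → N) : φ.Realize v xs ↔ φ.Realize w ys := by
  have hvar : ∀ {n : ℕ} (t : strictOrder.Term (Empty ⊕ Fin n)), ∃ i, t = Term.var (Sum.inr i) := by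
    intro n t
    obtain ⟨a | i, rfl⟩ := strictOrder_term_eq_var t
    exacts [a.elim, ⟨i, rfl⟩]
  induction φ generalizing k with
  | falsum => exact Iff.rfl
  | equal t₁ t₂ =>
    obtain ⟨i, rfl⟩ := hvar t₁
    obtain ⟨j, rfl⟩ := hvar t₂
    exact h.eq_iff i j
  | rel R ts =>
    cases R
    obtain ⟨i, hi⟩ := hvar (ts 0)
    obtain ⟨j, hj⟩ := hvar (ts 1)
    change (ts 0).realize (Sum.elim v xs) < (ts 1).realize (Sum.elim v xs) ↔
      (ts 0).realize (Sum.elim w ys) < (ts 1).realize (Sum.elim w ys)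
    rw [hi, hj]
    exact h.lt_iff i j
  | imp φ ψ ih₁ ih₂ =>
    simp only [BoundedFormula.complexity] at hk
    exact imp_congr (ih₁ (by omega) h) (ih₂ (by omega) h)
  | all φ ih =>
    obtain ⟨k, rfl⟩ := Nat.exists_eq_succ_of_ne_zero (Nat.ne_zero_of_lt hk)
    refine ⟨fun H y => ?_, fun H x => ?_⟩
    · obtain ⟨x, hx⟩ := h.symm.exists_snoc y
      exact (ih (Nat.le_of_succ_le_succ hk) hx.symm).1 (H x)
    · obtain ⟨y, hy⟩ := h.exists_snoc x
      exact (ih (Nat.le_of_succ_le_succ hk) hy).2 (H y)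

theorem realize_sentence_iff_of_depthType_eq (φ : strictOrder.Sentence)
    (h : depthType (BoundedFormula.complexity φ) (univ : Set M) =
      depthType (BoundedFormula.complexity φ) (univ : Set N)) : M ⊨ φ ↔ N ⊨ φ := by
  refine GameEquiv.realize_iff φ le_rfl ⟨fun i => i.elim0, fun c => ?_⟩ _ _
  rwa [show cutSet (default : Fin 0 → M) c = univ from eq_univ_of_forall fun z i => i.elim0,
    show cutSet (default : Fin 0 → N) c = univ from eq_univ_of_forall fun z i => i.elim0]

end Game

/-! ### Definability of types -/

section Definability

variable {M : Type*} [LinearOrder M] {n m k : ℕ}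

/-- A relation on `M` defined by a formula without parameters. -/
def IsDefinable (P : (Fin n → M) → Prop) : Prop :=
  ∃ φ : strictOrder.BoundedFormula Empty n, ∀ xs, φ.Realize default xs ↔ P xs

theorem isDefinable_const (p : Prop) : IsDefinable fun _ : Fin n → M => p := by
  by_cases h : p
  exacts [⟨⊤, fun xs => by simp [h]⟩, ⟨⊥, fun xs => by simp [h]⟩]

theorem isDefinable_lt (i j : Fin n) : IsDefinable fun xs : Fin n → M => xs i < xs j :=
  ⟨ltSymb.boundedFormula₂ (&i) (&j), fun _ => realize_ltSymb⟩

theorem isDefinable_le (i j : Fin n) : IsDefinable fun xs : Fin n → M => xs i ≤ xs j :=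
  ⟨∼(ltSymb.boundedFormula₂ (&j) (&i)), fun _ => by
    rw [BoundedFormula.realize_not, realize_ltSymb]
    exact not_lt⟩

namespace IsDefinable

theorem imp {P Q : (Fin n → M) → Prop} (hP : IsDefinable P) (hQ : IsDefinable Q) :
    IsDefinable fun xs => P xs → Q xs :=
  let ⟨φ, hφ⟩ := hP
  let ⟨ψ, hψ⟩ := hQ
  ⟨φ ⟹ ψ, fun xs => by rw [BoundedFormula.realize_imp, hφ, hψ]⟩

theorem and {P Q : (Fin n → M) → Prop} (hP : IsDefinable P) (hQ : IsDefinable Q) :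
    IsDefinable fun xs => P xs ∧ Q xs :=
  let ⟨φ, hφ⟩ := hP
  let ⟨ψ, hψ⟩ := hQ
  ⟨φ ⊓ ψ, fun xs => by rw [BoundedFormula.realize_inf, hφ, hψ]⟩

theorem iff {P Q : (Fin n → M) → Prop} (hP : IsDefinable P) (hQ : IsDefinable Q) :
    IsDefinable fun xs => (P xs ↔ Q xs) :=
  let ⟨φ, hφ⟩ := hP
  let ⟨ψ, hψ⟩ := hQ
  ⟨φ.iff ψ, fun xs => by rw [BoundedFormula.realize_iff, hφ, hψ]⟩

theorem forall_finite {β : Type*} [Finite β] {P : β → (Fin n → M) → Prop}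
    (hP : ∀ b, IsDefinable (P b)) : IsDefinable fun xs => ∀ b, P b xs := by
  choose φ hφ using hP
  exact ⟨BoundedFormula.iInf φ, fun xs => by simp [hφ]⟩

theorem all {P : (Fin n → M) → M → Prop}
    (hP : IsDefinable fun xs : Fin (n + 1) → M => P (fun i => xs i.castSucc) (xs (Fin.last n))) :
    IsDefinable fun xs => ∀ x, P xs x :=
  let ⟨φ, hφ⟩ := hP
  ⟨∀' φ, fun xs => by simp [BoundedFormula.realize_all, hφ]⟩

theorem ex {P : (Fin n → M) → M → Prop}
    (hP : IsDefinable fun xs : Fin (n + 1) → M => P (fun i => xs i.castSucc) (xs (Fin.last n))) :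
    IsDefinable fun xs => ∃ x, P xs x :=
  let ⟨φ, hφ⟩ := hP
  ⟨∃' φ, fun xs => by simp [BoundedFormula.realize_ex, hφ]⟩

theorem comp {P : (Fin n → M) → Prop} (hP : IsDefinable P) (f : Fin n → Fin m) :
    IsDefinable fun xs => P fun i => xs (f i) := by
  obtain ⟨φ, hφ⟩ := hP
  -- The variables `Fin n` are made free, renamed along `f`, and turned back into in-scope
  -- variables.
  refine ⟨BoundedFormula.relabel (n := m) (k := 0) (Sum.map id f) φ.toFormula, fun xs => ?_⟩
  rw [BoundedFormula.realize_relabel]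
  have := BoundedFormula.realize_toFormula φ
    (Sum.elim (default : Empty → M) (xs ∘ Fin.castAdd 0) ∘ Sum.map id f)
  rw [Formula.Realize, Subsingleton.elim (default : Fin 0 → M) (xs ∘ Fin.natAdd m)] at this
  rw [this]
  exact (iff_of_eq (congrArg₂ _ (Subsingleton.elim _ _) rfl)).trans (hφ fun i => xs (f i))

/-- The depth-`k` type of a definable family of sets is definable. -/
theorem depthType_eq {S : (Fin n → M) → Set M}
    (hS : IsDefinable fun xs : Fin (n + 1) → M => xs (Fin.last n) ∈ S fun i => xs i.castSucc)
    (t : DepthType k) : IsDefinable fun xs => depthType k (S xs) = t := by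
  induction k generalizing n with
  | zero => exact isDefinable_const (() = t)
  | succ k ih =>
    have := DepthType.finite k
    -- Since there are finitely many pairs `p` of types, the description of depth `k + 1` is a
    -- finite conjunction of formulas with one quantifier over depth-`k` statements.
    simp only [depthType_succ_eq]
    refine forall_finite fun p => (isDefinable_const _).iff (ex (hS.and ?_))
    -- The cutting point becomes the new parameter at index `n`, and the candidate member moves to
    -- index `n + 1`.
    have hS' : IsDefinable fun xs : Fin (n + 1 + 1) → M =>
        xs (Fin.last (n + 1)) ∈ S fun i => xs i.castSucc.castSucc := by
      simpa using hS.comp (Fin.snoc (fun i => i.castSucc.castSucc) (Fin.last (n + 1)) :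
        Fin (n + 1) → Fin (n + 1 + 1))
    exact (ih (S := fun xs => S (fun i => xs i.castSucc) ∩ Iio (xs (Fin.last n)))
        (hS'.and (isDefinable_lt _ _)) p.1).and
      (ih (S := fun xs => S (fun i => xs i.castSucc) ∩ Ioi (xs (Fin.last n)))
        (hS'.and (isDefinable_lt _ _)) p.2)

theorem depthType_mem {S : (Fin n → M) → Set M}
    (hS : IsDefinable fun xs : Fin (n + 1) → M => xs (Fin.last n) ∈ S fun i => xs i.castSucc)
    (A : Set (DepthType k)) : IsDefinable fun xs => depthType k (S xs) ∈ A := by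
  have := forall_finite fun t => (hS.depthType_eq t).imp (isDefinable_const (t ∈ A))
  simpa using this

end IsDefinable

end Definability

/-! ### The theory of transfinite induction -/

section TransfiniteInduction

theorem realize_transfiniteInduction {M : Type*} [LT M] {n : ℕ}
    (φ : strictOrder.BoundedFormula Empty (n + 1)) :
    M ⊨ transfiniteInduction φ ↔ ∀ xs : Fin n → M,
      (∀ x, (∀ y < x, φ.Realize default (Fin.snoc xs y : Fin (n + 1) → M)) →
        φ.Realize default (Fin.snoc xs x : Fin (n + 1) → M)) →
      ∀ x, φ.Realize default (Fin.snoc xs x : Fin (n + 1) → M) := by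
  have hlift : ∀ (xs : Fin n → M) (x y : M),
      (φ.liftAt 1 n).Realize (default : Empty → M)
        (Fin.snoc (Fin.snoc xs x : Fin (n + 1) → M) y : Fin (n + 1 + 1) → M) ↔
      φ.Realize default (Fin.snoc xs y : Fin (n + 1) → M) := by
    intro xs x y
    rw [BoundedFormula.realize_liftAt (by omega)]
    refine iff_of_eq (congrArg _ (funext fun i => ?_))
    induction i using Fin.lastCases with
    | last =>
      simp only [Function.comp, Fin.val_last, lt_irrefl, if_false, Fin.snoc_last]
      exact Fin.snoc_last (α := fun _ => M) y _
    | cast i =>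
      simp only [Function.comp, Fin.val_castSucc, i.2, if_true, Fin.snoc_castSucc]
      exact (Fin.snoc_castSucc (α := fun _ => M) _ _ i.castSucc).trans
        (Fin.snoc_castSucc (α := fun _ => M) _ _ i)
  rw [transfiniteInduction, Sentence.Realize, BoundedFormula.realize_alls]
  refine forall_congr' fun xs => ?_
  simp only [BoundedFormula.realize_imp, BoundedFormula.realize_all, realize_ltSymb, hlift,
    Function.comp_apply, Term.realize_var, Sum.elim_inr, Fin.snoc_last, Fin.snoc_castSucc]

theorem model_strictLinearOrderTheory_iff {M : Type*} [LT M] :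
    M ⊨ strictLinearOrderTheory ↔ Std.Irrefl (α := M) (· < ·) ∧ IsTrans M (· < ·) ∧
      ∀ a b : M, a < b ∨ a = b ∨ b < a := by
  simp only [strictLinearOrderTheory, Theory.model_iff, mem_insert_iff, mem_singleton_iff,
    forall_eq_or_imp, forall_eq]
  refine and_congr Relations.realize_irreflexive (and_congr Relations.realize_transitive ?_)
  simp only [Sentence.Realize, Formula.Realize, BoundedFormula.realize_all,
    BoundedFormula.realize_sup, realize_ltSymb, BoundedFormula.realize_bdEqual]
  rfl

theorem model_transfiniteInductionTheory (M : Type*) [LinearOrder M] [WellFoundedLT M] :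
    M ⊨ transfiniteInductionTheory := by
  refine Theory.Model.union ?_ ⟨?_⟩
  · exact model_strictLinearOrderTheory_iff.2 ⟨inferInstance, inferInstance, lt_trichotomy⟩
  · rintro _ ⟨n, φ, rfl⟩
    exact (realize_transfiniteInduction φ).2 fun xs h x => WellFoundedLT.induction x h

/-- A model of transfinite induction is equivalent to an ordinal below `ω ^ ω`, up to any given
depth. -/
theorem depthType_univ_mem_ordinalDepthTypes (M : Type*) [LinearOrder M]
    [M ⊨ transfiniteInductionTheory] (k : ℕ) :
    depthType k (univ : Set M) ∈ ordinalDepthTypes.{u} k := by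
  refine univ_mem_ordinalDepthTypes ?_
  -- The set of good types may be given in any way: finiteness of `DepthType k` makes membership in
  -- it definable. No parameters are needed in the induction formula.
  have hdef : IsDefinable fun xs : Fin 1 → M =>
      depthType k (Iio (xs (Fin.last 0))) ∈ ordinalDepthTypes.{u} k ∧
        ∀ a, a < xs (Fin.last 0) → depthType k (Ico a (xs (Fin.last 0))) ∈ ordinalDepthTypes.{u} k := by
    refine IsDefinable.and (IsDefinable.depthType_mem (isDefinable_lt (Fin.last 1) _) _)
      (IsDefinable.all ((isDefinable_lt _ _).imp (IsDefinable.depthType_mem ?_ _)))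
    exact (isDefinable_le (Fin.last 1).castSucc (Fin.last 2)).and (isDefinable_lt _ _)
  obtain ⟨φ, hφ⟩ := hdef
  have h := (realize_transfiniteInduction φ).1
    (Theory.realize_sentence_of_mem transfiniteInductionTheory (.inr ⟨0, φ, rfl⟩))
    (default : Fin 0 → M)
  simpa only [hφ, Fin.snoc_last] using h

end TransfiniteInduction

/-! ### Soundness of the proof calculus -/

section Soundness

variable {L : Language.{0, 0}} {M : Type*} [L.Structure M]

theorem realize_instantiate (φ : L.BoundedFormula ℕ 1) (t : L.Term ℕ) (v : ℕ → M) :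
    (φ.instantiate t).Realize v ↔ φ.Realize v fun _ => t.realize v := by
  rw [BoundedFormula.instantiate, Formula.Realize, BoundedFormula.realize_subst]
  exact BoundedFormula.realize_toFormula φ _

theorem realize_congr_of_eqOn_freeVarFinset {n : ℕ} (φ : L.BoundedFormula ℕ n) {v w : ℕ → M}
    (h : ∀ x ∈ φ.freeVarFinset, v x = w x) (xs : Fin n → M) :
    φ.Realize v xs ↔ φ.Realize w xs := by
  rw [← BoundedFormula.realize_restrictFreeVar' (s := φ.freeVarFinset) subset_rfl,
    ← BoundedFormula.realize_restrictFreeVar' (s := φ.freeVarFinset) (v := w) subset_rfl]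
  exact iff_of_eq (congrArg₂ _ (funext fun x => h x x.2) rfl)

theorem Theory.Derivable.realize {T : L.Theory} {φ : L.Formula ℕ} (h : T.Derivable φ) [M ⊨ T]
    (v : ℕ → M) : φ.Realize v := by
  induction h generalizing v with
  | ax σ h =>
    rw [Formula.realize_relabel, Subsingleton.elim (v ∘ Empty.elim) default]
    exact T.realize_sentence_of_mem h
  | mp φ ψ _ _ ih₁ ih₂ => exact ih₁ v (ih₂ v)
  | impK φ ψ => exact fun h _ => h
  | impS φ ψ χ => exact fun h h' h'' => h h'' (h' h'')
  | dne φ => exact fun h => not_not.1 h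
  | allE φ t => exact fun h => (realize_instantiate φ t v).2 (by
      convert h (t.realize v) using 1
      exact funext fun i => by rw [Fin.eq_zero i]; rfl)
  | gen ψ φ x hψ hφ _ ih =>
    intro h a
    -- Sending `x` to `a` affects neither `ψ` nor `φ`, as `x` is free in neither; it only changes
    -- the instantiated term.
    have hv : ∀ y, y ≠ x → v y = Function.update v x a y := fun y hy => by
      rw [Function.update_of_ne hy]
    have h1 := ih (Function.update v x a) ((realize_congr_of_eqOn_freeVarFinset ψ
      (fun y hy => hv y (ne_of_mem_of_not_mem hy hψ)) default).1 h)
    have h2 := (realize_instantiate φ (Term.var x) _).1 h1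
    rw [← realize_congr_of_eqOn_freeVarFinset φ
      (fun y hy => hv y (ne_of_mem_of_not_mem hy hφ))] at h2
    convert h2 using 1
    exact funext fun i => by simp [(Fin.eq_zero i : i = Fin.last 0), Fin.snoc]
  | eqRefl t => exact Formula.realize_equal.2 rfl
  | eqSubst φ s t =>
    intro h h'
    refine (realize_instantiate φ t v).2 ?_
    have h' := (realize_instantiate φ s v).1 h'
    rwa [← show s.realize v = t.realize v from Formula.realize_equal.1 h]

/-- The proof calculus is sound. -/
theorem Theory.Proves.realize {T : L.Theory} {σ : L.Sentence} (h : T.Proves σ) [Nonempty M]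
    [M ⊨ T] : M ⊨ σ := by
  have v : ℕ → M := fun _ => Classical.arbitrary M
  have := Theory.Derivable.realize h v
  rwa [Formula.realize_relabel, Subsingleton.elim (v ∘ Empty.elim) default] at this

end Soundness

/-! ### Henkin sets -/

section Henkin

variable {L : Language.{0, 0}} {T : L.Theory}

/-! ### Propositional derivations under a hypothesis -/

namespace Theory.Derivable

variable {φ ψ χ θ : L.Formula ℕ}

theorem weaken (h : T.Derivable φ) (ψ : L.Formula ℕ) : T.Derivable (ψ ⟹ φ) :=
  mp _ _ (impK φ ψ) h

/-- Modus ponens under a hypothesis `θ`; working in this form makes a deduction theorem unnecessary.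
-/
theorem ap (h : T.Derivable (θ ⟹ (φ ⟹ ψ))) (h' : T.Derivable (θ ⟹ φ)) :
    T.Derivable (θ ⟹ ψ) :=
  mp _ _ (mp _ _ (impS θ φ ψ) h) h'

theorem imp_self (φ : L.Formula ℕ) : T.Derivable (φ ⟹ φ) :=
  ap (impK φ (φ ⟹ φ)) (impK φ φ)

theorem trans (h : T.Derivable (φ ⟹ ψ)) (h' : T.Derivable (ψ ⟹ χ)) : T.Derivable (φ ⟹ χ) :=
  ap (h'.weaken φ) h

theorem imp_imp_right (h : T.Derivable (φ ⟹ ψ)) (θ : L.Formula ℕ) :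
    T.Derivable ((θ ⟹ φ) ⟹ (θ ⟹ ψ)) :=
  mp _ _ (impS θ φ ψ) (h.weaken θ)

theorem imp_imp_left (h : T.Derivable (φ ⟹ ψ)) (χ : L.Formula ℕ) :
    T.Derivable ((ψ ⟹ χ) ⟹ (φ ⟹ χ)) :=
  ap ((impK (ψ ⟹ χ) φ).trans (impS φ ψ χ)) (h.weaken _)

theorem exfalso (φ : L.Formula ℕ) : T.Derivable (⊥ ⟹ φ) :=
  (impK ⊥ (φ ⟹ ⊥)).trans (dne φ)

theorem not_imp (φ ψ : L.Formula ℕ) : T.Derivable ((φ ⟹ ⊥) ⟹ (φ ⟹ ψ)) :=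
  (exfalso ψ).imp_imp_right φ

/-- `(φ ⟹ (ψ ⟹ ⊥)) ⟹ ⊥` plays the role of the conjunction of `φ` and `ψ`. -/
theorem inf_left (φ ψ : L.Formula ℕ) : T.Derivable (((φ ⟹ (ψ ⟹ ⊥)) ⟹ ⊥) ⟹ φ) :=
  ((not_imp φ (ψ ⟹ ⊥)).imp_imp_left ⊥).trans (dne φ)

theorem inf_right (φ ψ : L.Formula ℕ) : T.Derivable (((φ ⟹ (ψ ⟹ ⊥)) ⟹ ⊥) ⟹ ψ) :=
  ((impK (ψ ⟹ ⊥) φ).imp_imp_left ⊥).trans (dne ψ)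

end Theory.Derivable

open Theory.Derivable

/-- A formula is consistent with `T` if `T` does not refute it. -/
def Theory.ConsistentFormula (T : L.Theory) : Type :=
  {φ : L.Formula ℕ // ¬ T.Derivable (φ ⟹ ⊥)}

/-- Consistent formulas, with the stronger formulas being the larger ones. -/
instance : Preorder T.ConsistentFormula where
  le φ ψ := T.Derivable (ψ.1 ⟹ φ.1)
  le_refl φ := imp_self φ.1
  le_trans _ _ _ h h' := h'.trans h

/-- A maximal consistent set of formulas with witnesses. -/
structure Theory.IsHenkin (T : L.Theory) (H : Set (L.Formula ℕ)) : Prop where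
  of_derivable : ∀ {φ}, T.Derivable φ → φ ∈ H
  mp : ∀ {φ ψ}, (φ ⟹ ψ) ∈ H → φ ∈ H → ψ ∈ H
  bot_notMem : ⊥ ∉ H
  mem_or : ∀ φ, φ ∈ H ∨ (φ ⟹ ⊥) ∈ H
  witness : ∀ φ : L.BoundedFormula ℕ 1, (∀' φ) ∉ H → ∃ x : ℕ, φ.instantiate (Term.var x) ∉ H

/-- The consistent formulas deciding `θ`, with a witness if a universal formula is refuted. -/
def Theory.deciding (T : L.Theory) (θ : L.Formula ℕ) : Order.Cofinal T.ConsistentFormula where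
  carrier := {ψ | T.Derivable (ψ.1 ⟹ θ) ∨ T.Derivable (ψ.1 ⟹ (θ ⟹ ⊥)) ∧
    ∀ φ : L.BoundedFormula ℕ 1, θ = ∀' φ →
      ∃ x : ℕ, T.Derivable (ψ.1 ⟹ (φ.instantiate (Term.var x) ⟹ ⊥))}
  isCofinal ψ := by
    -- The conjunction of `ψ` and `χ` is consistent unless `ψ` refutes `χ`.
    have hcons : ∀ χ, ¬ T.Derivable (ψ.1 ⟹ (χ ⟹ ⊥)) →
        ¬ T.Derivable (((ψ.1 ⟹ (χ ⟹ ⊥)) ⟹ ⊥) ⟹ ⊥) := fun χ h h' => h (.mp _ _ (dne _) h')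
    by_cases h : T.Derivable (ψ.1 ⟹ (θ ⟹ ⊥))
    · by_cases hθ : ∃ φ : L.BoundedFormula ℕ 1, θ = ∀' φ
      · obtain ⟨φ, rfl⟩ := hθ
        -- A variable fresh for `ψ` and `φ` acts as a Henkin constant. If `ψ` refuted the negation
        -- of `φ(x)`, it would prove `φ(x)`, hence `∀' φ` by generalization, although it refutes `∀'
        -- φ`.
        obtain ⟨x, hx⟩ := Infinite.exists_notMem_finset (ψ.1.freeVarFinset ∪ φ.freeVarFinset)
        rw [Finset.mem_union, not_or] at hx
        refine ⟨⟨_, hcons (φ.instantiate (Term.var x) ⟹ ⊥) fun h' => ψ.2 (h.ap ?_)⟩,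
          .inr ⟨(inf_left _ _).trans h, ?_⟩, inf_left _ _⟩
        · exact gen _ _ x hx.1 hx.2 (h'.trans (dne _))
        · intro φ' hφ'
          cases hφ'
          exact ⟨x, inf_right _ _⟩
      · exact ⟨ψ, .inr ⟨h, fun φ hφ => (hθ ⟨φ, hφ⟩).elim⟩, le_rfl⟩
    · exact ⟨⟨_, hcons θ h⟩, .inl (inf_right _ _), inf_left _ _⟩

/-- Every consistent formula belongs to a Henkin set. -/
theorem Theory.ConsistentFormula.exists_isHenkin [Countable (L.Formula ℕ)]
    (ψ : T.ConsistentFormula) : ∃ H, T.IsHenkin H ∧ ψ.1 ∈ H := by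
  have := Encodable.ofCountable (L.Formula ℕ)
  -- A generic ideal through `ψ`, by the Rasiowa–Sikorski lemma. Its consequences `H` are closed
  -- under modus ponens because `I` is directed, and omit `⊥` because each member of `I` is
  -- consistent.
  let I := Order.idealOfCofinals ψ T.deciding
  let H : Set (L.Formula ℕ) := {φ | ∃ χ ∈ I, T.Derivable (χ.1 ⟹ φ)}
  have hmp : ∀ {φ ψ}, (φ ⟹ ψ) ∈ H → φ ∈ H → ψ ∈ H := by
    rintro φ ψ ⟨χ₁, h₁, h₁'⟩ ⟨χ₂, h₂, h₂'⟩
    obtain ⟨χ, h, hχ₁, hχ₂⟩ := I.directed χ₁ h₁ χ₂ h₂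
    have hχ₁ : T.Derivable (χ.1 ⟹ χ₁.1) := hχ₁
    have hχ₂ : T.Derivable (χ.1 ⟹ χ₂.1) := hχ₂
    exact ⟨χ, h, (hχ₁.trans h₁').ap (hχ₂.trans h₂')⟩
  have hbot : ⊥ ∉ H := fun ⟨χ, _, h⟩ => χ.2 h
  refine ⟨H, ⟨fun h => ?_, hmp, hbot, fun φ => ?_, fun φ hφ => ?_⟩,
    ψ, Order.mem_idealOfCofinals _ _, imp_self _⟩
  · exact ⟨ψ, Order.mem_idealOfCofinals _ _, h.weaken _⟩
  · obtain ⟨χ, h, hχ⟩ := Order.cofinal_meets_idealOfCofinals ψ T.deciding φ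
    exact h.imp (fun h => ⟨χ, hχ, h⟩) fun h => ⟨χ, hχ, h.1⟩
  · obtain ⟨χ, h | ⟨-, h⟩, hχ⟩ := Order.cofinal_meets_idealOfCofinals ψ T.deciding (∀' φ)
    · exact (hφ ⟨χ, hχ, h⟩).elim
    · obtain ⟨x, hx⟩ := h φ rfl
      exact ⟨x, fun hn => hbot (hmp ⟨χ, hχ, hx⟩ hn)⟩

namespace Theory.IsHenkin

variable {H : Set (L.Formula ℕ)}

theorem imp_mem_iff (h : T.IsHenkin H) {φ ψ : L.Formula ℕ} :
    (φ ⟹ ψ) ∈ H ↔ (φ ∈ H → ψ ∈ H) := by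
  refine ⟨h.mp, fun h' => ?_⟩
  rcases h.mem_or φ with hφ | hφ
  · exact h.mp (h.of_derivable (impK ψ φ)) (h' hφ)
  · exact h.mp (h.of_derivable (not_imp φ ψ)) hφ

theorem all_mem_iff (h : T.IsHenkin H) {φ : L.BoundedFormula ℕ 1} :
    (∀' φ) ∈ H ↔ ∀ x : ℕ, φ.instantiate (Term.var x) ∈ H := by
  refine ⟨fun h' x => h.mp (h.of_derivable (allE φ _)) h', fun h' => by_contra fun hn => ?_⟩
  obtain ⟨x, hx⟩ := h.witness φ hn
  exact hx (h' x)

theorem equal_subst (h : T.IsHenkin H) (φ : L.BoundedFormula ℕ 1) {s t : L.Term ℕ}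
    (hst : s.equal t ∈ H) (hs : φ.instantiate s ∈ H) : φ.instantiate t ∈ H :=
  h.mp (h.mp (h.of_derivable (eqSubst φ s t)) hst) hs

theorem equal_equivalence (h : T.IsHenkin H) :
    Equivalence fun x y : ℕ => (Term.var x : L.Term ℕ).equal (Term.var y) ∈ H where
  refl _ := h.of_derivable (eqRefl _)
  -- Symmetry substitutes into `w = x`, starting from `x = x`; transitivity substitutes into `x =
  -- w`.
  symm {x _} hxy := h.equal_subst (Term.bdEqual (&0) (Term.var (Sum.inl x))) hxy
    (h.of_derivable (eqRefl _))
  trans {x _ _} hxy hyz := h.equal_subst (Term.bdEqual (Term.var (Sum.inl x)) (&0)) hyz hxy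

end Theory.IsHenkin

/-! ### Complexity and substitution -/

namespace BoundedFormula

variable {α β : Type*}

theorem complexity_castLE {m n : ℕ} (h : m ≤ n) (φ : L.BoundedFormula α m) :
    (φ.castLE h).complexity = φ.complexity := by
  induction φ generalizing n with
  | falsum => rfl
  | equal => rfl
  | rel => rfl
  | imp φ ψ ih₁ ih₂ => simp only [castLE, complexity, ih₁, ih₂]
  | all φ ih => simp only [castLE, complexity, ih]

theorem complexity_mapTermRel {L' : Language.{0, 0}} {g : ℕ → ℕ}
    (ft : ∀ n, L.Term (α ⊕ (Fin n)) → L'.Term (β ⊕ (Fin (g n))))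
    (fr : ∀ n, L.Relations n → L'.Relations n)
    (h : ∀ n, L'.BoundedFormula β (g (n + 1)) → L'.BoundedFormula β (g n + 1))
    (hh : ∀ n φ, (h n φ).complexity = φ.complexity) {n : ℕ} (φ : L.BoundedFormula α n) :
    (φ.mapTermRel ft fr h).complexity = φ.complexity := by
  induction φ with
  | falsum => rfl
  | equal => rfl
  | rel => rfl
  | imp φ ψ ih₁ ih₂ => simp only [mapTermRel, complexity, ih₁, ih₂]
  | all φ ih => simp only [mapTermRel, complexity, hh, ih]

theorem complexity_relabel {m n : ℕ} (g : α → β ⊕ Fin m) (φ : L.BoundedFormula α n) :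
    (φ.relabel g).complexity = φ.complexity :=
  complexity_mapTermRel _ _ _ (fun _ _ => complexity_castLE _ _) φ

theorem complexity_toFormula {n : ℕ} (φ : L.BoundedFormula α n) :
    complexity φ.toFormula = φ.complexity := by
  induction φ with
  | falsum => rfl
  | equal => rfl
  | rel => rfl
  | imp φ ψ ih₁ ih₂ => exact congrArg₂ (· + · + 1) ih₁ ih₂
  | all φ ih => exact congrArg (· + 1) ((complexity_relabel _ _).trans ih)

/-- Instances of `φ` are not subformulas of `∀' φ`, so the truth lemma cannot be proved by
structural induction. It goes by induction on complexity, which instantiation preserves. -/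
theorem complexity_instantiate (φ : L.BoundedFormula ℕ 1) (t : L.Term ℕ) :
    complexity (φ.instantiate t) = φ.complexity :=
  (complexity_mapTermRel (g := id)
    (fun _ t' => t'.subst (Sum.elim (Term.relabel Sum.inl ∘ Sum.elim Term.var fun _ => t)
      (Term.var ∘ Sum.inr))) (fun _ => id) (fun _ => id) (fun _ _ => rfl)
    φ.toFormula).trans (complexity_toFormula φ)

end BoundedFormula

end Henkin

/-! ### Completeness for the language of strict orders -/

section Completeness

variable {T : strictOrder.Theory} {H : Set (strictOrder.Formula ℕ)}

instance : Countable strictOrder.Symbols := by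
  have : Countable (Σ n, strictOrder.Functions n) :=
    ⟨fun x => Empty.elim x.2, fun x => Empty.elim x.2⟩
  have : Countable (Σ n, strictOrder.Relations n) :=
    ⟨fun _ => 0, fun ⟨_, .lt⟩ ⟨_, .lt⟩ _ => rfl⟩
  exact inferInstanceAs (Countable (_ ⊕ _))

theorem formula₂_lt_eq (ts : Fin 2 → strictOrder.Term (ℕ ⊕ Fin 0)) {x y : ℕ}
    (h₀ : ts 0 = Term.var (Sum.inl x)) (h₁ : ts 1 = Term.var (Sum.inl y)) :
    BoundedFormula.rel StrictOrderRel.lt ts =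
      ltSymb.formula₂ (Term.var x : strictOrder.Term ℕ) (Term.var y) := by
  refine congrArg (BoundedFormula.rel (L := strictOrder) StrictOrderRel.lt) (funext fun i => ?_)
  fin_cases i
  exacts [h₀, h₁]

namespace Theory.IsHenkin

theorem lt_congr_left (h : T.IsHenkin H) {x y z : ℕ}
    (hxy : (Term.var x : strictOrder.Term ℕ).equal (Term.var y) ∈ H)
    (hxz : ltSymb.formula₂ (Term.var x : strictOrder.Term ℕ) (Term.var z) ∈ H) :
    ltSymb.formula₂ (Term.var y : strictOrder.Term ℕ) (Term.var z) ∈ H := by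
  have key : ∀ w : ℕ, (ltSymb.boundedFormula₂ (&0) (Term.var (Sum.inl z))).instantiate
      (Term.var w) = ltSymb.formula₂ (Term.var w : strictOrder.Term ℕ) (Term.var z) :=
    fun w => formula₂_lt_eq _ rfl rfl
  rw [← key] at hxz ⊢
  exact h.equal_subst _ hxy hxz

theorem lt_congr_right (h : T.IsHenkin H) {x y z : ℕ}
    (hxy : (Term.var x : strictOrder.Term ℕ).equal (Term.var y) ∈ H)
    (hxz : ltSymb.formula₂ (Term.var z : strictOrder.Term ℕ) (Term.var x) ∈ H) :
    ltSymb.formula₂ (Term.var z : strictOrder.Term ℕ) (Term.var y) ∈ H := by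
  have key : ∀ w : ℕ, (ltSymb.boundedFormula₂ (Term.var (Sum.inl z)) (&0)).instantiate
      (Term.var w) = ltSymb.formula₂ (Term.var z : strictOrder.Term ℕ) (Term.var w) :=
    fun w => formula₂_lt_eq _ rfl rfl
  rw [← key] at hxz ⊢
  exact h.equal_subst _ hxy hxz

/-- The identification of variables which a Henkin set proves to be equal. -/
def setoid (h : T.IsHenkin H) : Setoid ℕ := ⟨_, h.equal_equivalence⟩

/-- The term model of a Henkin set. -/
def TermModel (h : T.IsHenkin H) : Type := Quotient h.setoid

instance (h : T.IsHenkin H) : LT h.TermModel where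
  lt := Quotient.lift₂
    (fun x y => ltSymb.formula₂ (Term.var x : strictOrder.Term ℕ) (Term.var y) ∈ H)
    fun _ _ _ _ h₁ h₂ => propext
      ⟨fun h' => h.lt_congr_left h₁ (h.lt_congr_right h₂ h'), fun h' =>
        h.lt_congr_left (h.setoid.symm h₁) (h.lt_congr_right (h.setoid.symm h₂) h')⟩

instance (h : T.IsHenkin H) : Nonempty h.TermModel := ⟨Quotient.mk h.setoid 0⟩

/-- The class of a variable in the term model. -/
def toTermModel (h : T.IsHenkin H) (x : ℕ) : h.TermModel := Quotient.mk h.setoid x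

/-- The truth lemma. -/
theorem mem_iff_realize (h : T.IsHenkin H) (φ : strictOrder.Formula ℕ) :
    φ ∈ H ↔ φ.Realize h.toTermModel := by
  have hvar : ∀ t : strictOrder.Term (ℕ ⊕ Fin 0), ∃ x, t = Term.var (Sum.inl x) := by
    intro t
    obtain ⟨x | i, rfl⟩ := strictOrder_term_eq_var t
    exacts [⟨x, rfl⟩, i.elim0]
  induction hn : BoundedFormula.complexity φ using Nat.strong_induction_on generalizing φ with
  | _ n ih =>
    replace ih : ∀ ψ : strictOrder.Formula ℕ, BoundedFormula.complexity ψ < n →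
      (ψ ∈ H ↔ ψ.Realize h.toTermModel) := fun ψ hψ => ih _ hψ ψ rfl
    cases φ with
    | falsum => exact iff_of_false h.bot_notMem id
    | equal t₁ t₂ =>
      obtain ⟨x, rfl⟩ := hvar t₁
      obtain ⟨y, rfl⟩ := hvar t₂
      exact (Quotient.eq (r := h.setoid) (x := x) (y := y)).symm
    | rel R ts =>
      cases R
      obtain ⟨x, hx⟩ := hvar (ts 0)
      obtain ⟨y, hy⟩ := hvar (ts 1)
      rw [formula₂_lt_eq ts hx hy, Formula.realize_rel₂]
      rfl
    | imp φ ψ =>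
      simp only [BoundedFormula.complexity] at hn
      rw [h.imp_mem_iff, ih φ (by omega), ih ψ (by omega)]
      rfl
    | all φ =>
      simp only [BoundedFormula.complexity] at hn
      have key : ∀ x : ℕ, φ.instantiate (Term.var x) ∈ H ↔
          φ.Realize h.toTermModel (Fin.snoc default (h.toTermModel x) : Fin 1 → h.TermModel) := by
        intro x
        rw [ih _ (by rw [φ.complexity_instantiate]; omega), realize_instantiate]
        refine iff_of_eq (congrArg _ (funext fun i => ?_))
        rw [Fin.eq_zero i]
        rfl
      rw [h.all_mem_iff]
      simp only [key]
      exact ⟨fun h' a => Quotient.inductionOn a h', fun h' x => h' (h.toTermModel x)⟩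

theorem model_termModel (h : T.IsHenkin H) : h.TermModel ⊨ T := by
  refine ⟨fun σ hσ => ?_⟩
  have := (h.mem_iff_realize _).1 (h.of_derivable (Derivable.ax σ hσ))
  rwa [Formula.realize_relabel,
    Subsingleton.elim (h.toTermModel ∘ Empty.elim) default] at this

end Theory.IsHenkin

/-- Gödel's completeness theorem for the language of strict orders. -/
theorem Theory.proves_of_forall_model {σ : strictOrder.Sentence}
    (h : ∀ (M : Type) [LT M] [Nonempty M], M ⊨ T → M ⊨ σ) : T.Proves σ := by
  by_contra hσ
  obtain ⟨H, hH, hmem⟩ := Theory.ConsistentFormula.exists_isHenkin (T := T)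
    ⟨Formula.relabel (Empty.elim : Empty → ℕ) σ ⟹ ⊥, fun h' => hσ (.mp _ _ (.dne _) h')⟩
  have h1 := (hH.mem_iff_realize _).1 hmem
  refine h1 ?_
  change (Formula.relabel (Empty.elim : Empty → ℕ) σ).Realize hH.toTermModel
  rw [Formula.realize_relabel, Subsingleton.elim (hH.toTermModel ∘ Empty.elim) default]
  exact h _ hH.model_termModel

end Completeness

/-! ### The equivalence -/

theorem depthType_univ_toType (α : Ordinal.{u}) (k : ℕ) :
    depthType k (Set.univ : Set α.ToType) = depthType k (Set.Iio α) := by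
  rw [← depthType_image (f := fun x : α.ToType => ((Ordinal.ToType.mk.symm x : Set.Iio α) : Ordinal))
    (fun _ _ h => Ordinal.ToType.mk.symm.strictMono h)]
  congr 1
  ext β
  constructor
  · rintro ⟨x, -, rfl⟩
    exact (Ordinal.ToType.mk.symm x).2
  · exact fun h => ⟨Ordinal.ToType.mk ⟨β, h⟩, trivial, by simp⟩

theorem realize_of_model_transfiniteInductionTheory {φ : strictOrder.Sentence}
    (h : ∀ α : Ordinal.{u}, 0 < α → α < Ordinal.omega0 ^ Ordinal.omega0 → α.ToType ⊨ φ)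
    (M : Type*) [LinearOrder M] [Nonempty M] [M ⊨ transfiniteInductionTheory] : M ⊨ φ := by
  obtain ⟨α, hα, e⟩ := depthType_univ_mem_ordinalDepthTypes.{u} M
    -- The extra round guarantees positive depth, at which nonemptiness of `M` forces `α` to be
    -- nonzero.
    (BoundedFormula.complexity φ + 1)
  rw [← depthType_univ_toType] at e
  refine (realize_sentence_iff_of_depthType_eq φ (depthType_eq_of_succ e)).1 (h α ?_ hα)
  obtain ⟨x, -⟩ := exists_of_depthType_succ_eq e.symm (Set.mem_univ (Classical.arbitrary M))
  rw [pos_iff_ne_zero, ← Ordinal.nonempty_toType_iff]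
  exact ⟨x⟩

/-- The linear order of a model of transfinite induction. -/
theorem exists_linearOrder_of_model {M : Type*} [inst : LT M]
    (h : M ⊨ transfiniteInductionTheory) : ∃ o : LinearOrder M, o.toLT = inst := by
  obtain ⟨h₁, h₂, h₃⟩ := model_strictLinearOrderTheory_iff.1 (h.mono Set.subset_union_left)
  classical
  have : Std.Trichotomous (α := M) (· < ·) :=
    ⟨fun a b hab hba => ((h₃ a b).resolve_left hab).resolve_right hba⟩
  have : IsStrictTotalOrder M (· < ·) := {}
  exact ⟨linearOrderOfSTO (· < ·), rfl⟩

end FirstOrder.Language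

open FirstOrder FirstOrder.Language in
theorem theorem1 (φ : strictOrder.Sentence) :
    [ ∀ (M : Type u) [LinearOrder M] [WellFoundedLT M] [Nonempty M], M ⊨ φ,
      ∀ α : Ordinal.{u}, 0 < α → α < Ordinal.omega0 ^ Ordinal.omega0 → α.ToType ⊨ φ,
      transfiniteInductionTheory.Proves φ ].TFAE := by
  tfae_have 1 → 2 := fun h α hα _ =>
    have := Ordinal.nonempty_toType_iff.2 hα.ne'
    h α.ToType
  -- Here `M` lies in `Type` while the ordinals lie in universe `u`; depth types take values in
  -- `DepthType k` independently of the universe, so the two can be compared.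
  tfae_have 2 → 3 := fun h => Theory.proves_of_forall_model fun M _ _ hM => by
    obtain ⟨o, rfl⟩ := exists_linearOrder_of_model hM
    exact realize_of_model_transfiniteInductionTheory h M
  tfae_have 3 → 1 := fun h M _ _ _ =>
    have := model_transfiniteInductionTheory M
    h.realize
  tfae_finish
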